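/- A category $\mathbb C$ is called exact (in the sense of Barr) if it has finite limits, every morphism factors as a regular epimorphism followed by a monomorphism, regular epimorphisms are stable under pullback, and every internal equivalence relation in $\mathbb C$ is effective, i.e. is the kernel pair of some morphism. A relation on an object $A$ is a subobject $\langle r_1,r_2\rangle\colon\rho\rightarrowtail A\times A$; its opposite is $\rho^o=\langle r_2,r_1\rangle$, and $\Delta_A=\langle 1_A,1_A\rangle$. The relation $\rho$ is reflexive if $\Delta_A\le\rho$, transitive if there is $\tau\colon\rho\times_A\rho\to\rho$ (where $\rho\times_A\rho$ is the pullback of $r_2$ and $r_1$, with projections $p_1,p_2$) such that $r_1\tau=r_1p_1$ and $r_2\tau=r_2p_2$, and symmetric if there is $\gamma\colon\rho\to\rho$ with $r_1\gamma=r_2$ and $r_2\gamma=r_1$. A preorder on $A$ is a reflexive and transitive relation; put ${\sim_\rho}=\rho\wedge\rho^o$ for it. A preorder is an equivalence relation if it is symmetric, and a partial order if ${\sim_\rho}=\Delta_A$. **Corollary.** Let $\mathbb C$ be an exact category and $A$ an object of $\mathbb C$. For an equivalence relation $R$ on $A$ let $q_R\colon A\to A/R$ be the coequalizer of the two projections of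 $R$ (which exists). Then there is a bijection between 1. preorders $\rho$ on $A$; 2. pairs $(R,\le)$, where $R$ is an equivalence relation on $A$ and $\le$ is a partial order on $A/R$. It sends a preorder $\rho$ to the pair $({\sim_\rho},\pi(\rho))$, where $\pi=q_{\sim_\rho}$ and $\pi(\rho)$, the image of the composite $\rho\rightarrowtail A\times A\xrightarrow{\pi\times\pi}A/{\sim_\rho}\times A/{\sim_\rho}$, is a partial order on $A/{\sim_\rho}$. Its inverse sends $(R,\le)$ to the preorder $q_R^{-1}(\le)$ on $A$, the pullback of $\le$ along $q_R\times q_R\colon A\times A\to A/R\times A/R$. -/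

import Mathlib

open CategoryTheory CategoryTheory.Limits

universe v u

noncomputable section

namespace InternalOrder

/-- A (Barr-)exact category: a regular category in which every internal equivalence relation
is effective, that is, is the kernel pair of some arrow. -/
class ExactCategory (C : Type u) [Category.{v} C] : Prop extends Regular C where
  effective : ∀ {R X : C} (p₁ p₂ : R ⟶ X), IsEquivalenceRelation p₁ p₂ →
    ∃ (Y : C) (f : X ⟶ Y), IsKernelPair f p₁ p₂

section FiniteLimits

variable {C : Type u} [Category.{v} C] [HasFiniteLimits C]

/-- An internal relation on `A`, i.e. a subobject `⟨r₁, r₂⟩ : r ⟶ A ⨯ A`. -/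
abbrev InternalRel (A : C) := Subobject (A ⨯ A)

namespace InternalRel

variable {A B : C}

/-- The first leg `r₁` of a relation. -/
def fst (r : InternalRel A) : (r : C) ⟶ A := r.arrow ≫ prod.fst

/-- The second leg `r₂` of a relation. -/
def snd (r : InternalRel A) : (r : C) ⟶ A := r.arrow ≫ prod.snd

theorem lift_fst_snd (r : InternalRel A) : prod.lift r.fst r.snd = r.arrow := by
  ext <;> simp [fst, snd, prod.lift_fst, prod.lift_snd]

theorem hom_ext (r : InternalRel A) {T : C} {f g : T ⟶ (r : C)}
    (h₁ : f ≫ r.fst = g ≫ r.fst) (h₂ : f ≫ r.snd = g ≫ r.snd) : f = g := by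
  rw [← cancel_mono r.arrow]
  ext
  · simpa [fst] using h₁
  · simpa [snd] using h₂

instance (r : InternalRel A) : Mono (prod.lift r.snd r.fst) where
  right_cancellation f g h := by
    apply r.hom_ext
    · simpa [prod.lift_snd] using congrArg (· ≫ prod.snd) h
    · simpa [prod.lift_fst] using congrArg (· ≫ prod.fst) h

/-- The discrete relation `Δ_A = ⟨1_A, 1_A⟩`. -/
def discrete (A : C) : InternalRel A := Subobject.mk (diag A)

/-- The opposite relation `⟨r₂, r₁⟩`. -/
def opp (r : InternalRel A) : InternalRel A := Subobject.mk (prod.lift r.snd r.fst)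

/-- The relation `r ∧ rᵒ` (written `∼_r` when `r` is a preorder). -/
def sim (r : InternalRel A) : InternalRel A := r ⊓ r.opp

/-- `r` contains the discrete relation. -/
def IsReflexive (r : InternalRel A) : Prop := discrete A ≤ r

/-- There is `τ : r ×_A r ⟶ r` with `r₁ τ = r₁ p₁` and `r₂ τ = r₂ p₂`, where `r ×_A r` is the
pullback of `r₂` and `r₁`. -/
def IsTransitive (r : InternalRel A) : Prop :=
  ∃ τ : pullback r.snd r.fst ⟶ (r : C),
    τ ≫ r.fst = pullback.fst r.snd r.fst ≫ r.fst ∧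
    τ ≫ r.snd = pullback.snd r.snd r.fst ≫ r.snd

/-- There is `γ : r ⟶ r` with `r₁ γ = r₂` and `r₂ γ = r₁`. -/
def IsSymmetric (r : InternalRel A) : Prop :=
  ∃ γ : (r : C) ⟶ (r : C), γ ≫ r.fst = r.snd ∧ γ ≫ r.snd = r.fst

/-- `r ∧ rᵒ` is the discrete relation. -/
def IsAntisymmetric (r : InternalRel A) : Prop := r.sim = discrete A

/-- Internal preorders. -/
structure IsPreorder (r : InternalRel A) : Prop where
  refl : r.IsReflexive
  trans : r.IsTransitive

/-- Internal equivalence relations. -/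
structure IsEquivalence (r : InternalRel A) : Prop extends IsPreorder r where
  symm : r.IsSymmetric

/-- Internal partial orders. -/
structure IsPartialOrder (r : InternalRel A) : Prop extends IsPreorder r where
  antisymm : r.IsAntisymmetric

/-- The inverse image `f⁻¹(s)`: the pullback of `s ⟶ B ⨯ B` along `f × f`. -/
def inverseImage (f : A ⟶ B) (s : InternalRel B) : InternalRel A :=
  (Subobject.pullback (prod.map f f)).obj s

theorem factors_iff (r : InternalRel A) {T : C} (x y : T ⟶ A) :
    r.Factors (prod.lift x y) ↔ ∃ t : T ⟶ (r : C), t ≫ r.fst = x ∧ t ≫ r.snd = y := by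
  constructor
  · intro h
    exact ⟨r.factorThru _ h, by simp [fst, prod.lift_fst], by simp [snd, prod.lift_snd]⟩
  · rintro ⟨t, rfl, rfl⟩
    rw [← prod.comp_lift, lift_fst_snd]
    exact Subobject.factors_comp_arrow t

theorem opp_factors_iff (r : InternalRel A) {T : C} (x y : T ⟶ A) :
    r.opp.Factors (prod.lift x y) ↔ r.Factors (prod.lift y x) := by
  rw [factors_iff r, opp, Subobject.mk_factors_iff]
  constructor
  · rintro ⟨(t : T ⟶ (r : C)), (ht : t ≫ prod.lift r.snd r.fst = prod.lift x y)⟩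
    rw [prod.comp_lift] at ht
    exact ⟨t, by simpa [prod.lift_snd] using congrArg (· ≫ prod.snd) ht,
      by simpa [prod.lift_fst] using congrArg (· ≫ prod.fst) ht⟩
  · rintro ⟨t, rfl, rfl⟩
    exact ⟨t, by simp⟩

theorem sim_factors_iff (r : InternalRel A) {T : C} (x y : T ⟶ A) :
    r.sim.Factors (prod.lift x y) ↔ r.Factors (prod.lift x y) ∧ r.Factors (prod.lift y x) := by
  rw [sim, Subobject.inf_factors, opp_factors_iff]

theorem isReflexive_iff (r : InternalRel A) :
    r.IsReflexive ↔ r.Factors (prod.lift (𝟙 A) (𝟙 A)) := by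
  constructor
  · intro h
    exact Subobject.factors_of_le _ h ((Subobject.mk_factors_iff _ _).2 ⟨𝟙 _, by simp⟩)
  · intro h
    exact Subobject.mk_le_of_comm (r.factorThru _ h) (by simp)

theorem isTransitive_iff (r : InternalRel A) :
    r.IsTransitive ↔ ∀ ⦃T : C⦄ (x y z : T ⟶ A), r.Factors (prod.lift x y) →
      r.Factors (prod.lift y z) → r.Factors (prod.lift x z) := by
  constructor
  · rintro ⟨τ, h₁, h₂⟩ T x y z hxy hyz
    obtain ⟨s, hs₁, hs₂⟩ := (r.factors_iff _ _).1 hxy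
    obtain ⟨t, ht₁, ht₂⟩ := (r.factors_iff _ _).1 hyz
    refine (r.factors_iff _ _).2 ⟨pullback.lift s t (hs₂.trans ht₁.symm) ≫ τ, ?_, ?_⟩
    · simp [h₁, hs₁, pullback.lift_fst_assoc]
    · simp [h₂, ht₂, pullback.lift_snd_assoc]
  · intro h
    exact (r.factors_iff _ _).1 (h _ (pullback.fst r.snd r.fst ≫ r.snd) _
      ((r.factors_iff _ _).2 ⟨pullback.fst r.snd r.fst, rfl, rfl⟩)
      ((r.factors_iff _ _).2 ⟨pullback.snd r.snd r.fst, pullback.condition.symm, rfl⟩))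

theorem IsPreorder.isEquivalence_sim {r : InternalRel A} (h : r.IsPreorder) :
    r.sim.IsEquivalence where
  refl := by
    have := (r.isReflexive_iff).1 h.refl
    exact (isReflexive_iff _).2 ((r.sim_factors_iff _ _).2 ⟨this, this⟩)
  trans := by
    have ht := (r.isTransitive_iff).1 h.trans
    refine (isTransitive_iff _).2 fun T x y z hxy hyz => ?_
    rw [sim_factors_iff] at *
    exact ⟨ht _ _ _ hxy.1 hyz.1, ht _ _ _ hyz.2 hxy.2⟩
  symm := by
    have h' : r.sim.Factors (prod.lift r.sim.fst r.sim.snd) :=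
      (factors_iff _ _ _).2 ⟨𝟙 _, by simp, by simp⟩
    rw [sim_factors_iff] at h'
    exact (factors_iff _ _ _).1 ((r.sim_factors_iff _ _).2 ⟨h'.2, h'.1⟩)

theorem IsEquivalence.isEquivalenceRelation {r : InternalRel A} (h : r.IsEquivalence) :
    IsEquivalenceRelation r.fst r.snd := by
  obtain ⟨e, he₁, he₂⟩ := (r.factors_iff _ _).1 ((r.isReflexive_iff).1 h.refl)
  obtain ⟨γ, hγ₁, hγ₂⟩ := h.symm
  obtain ⟨τ, hτ₁, hτ₂⟩ := h.trans
  exact ⟨⟨{ right_cancellation := fun _ _ _ h₁ h₂ => r.hom_ext h₁ h₂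
            r := e, reflexivity₁ := he₁, reflexivity₂ := he₂
            s := γ, symmetry₁ := hγ₁, symmetry₂ := hγ₂
            c := pullback.cone r.snd r.fst, isLimit := pullback.isLimit r.snd r.fst
            t := τ, transitivity₁ := hτ₁, transitivity₂ := hτ₂ }⟩⟩

end InternalRel

/-- Preorder structures on `A`. -/
abbrev InternalPreorder (A : C) := {r : InternalRel A // r.IsPreorder}

/-- Equivalence relations on `A`. -/
abbrev InternalEquivalence (A : C) := {r : InternalRel A // r.IsEquivalence}

/-- Partial order structures on `A`. -/
abbrev InternalPartialOrder (A : C) := {r : InternalRel A // r.IsPartialOrder}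

/-- The equivalence relation `∼_ρ = ρ ∧ ρᵒ` of a preorder `ρ`. -/
def InternalPreorder.sim {A : C} (ρ : InternalPreorder A) : InternalEquivalence A :=
  ⟨ρ.1.sim, ρ.2.isEquivalence_sim⟩

end FiniteLimits

section Exact

variable {C : Type u} [Category.{v} C] [ExactCategory C]

/-- The direct image `f(r)`: the regular image of `r ⟶ A ⨯ A ⟶ B ⨯ B`. -/
def InternalRel.directImage {A B : C} (f : A ⟶ B) (r : InternalRel A) : InternalRel B :=
  imageSubobject (r.arrow ≫ prod.map f f)

instance {A : C} (R : InternalEquivalence A) : HasCoequalizer R.1.fst R.1.snd := by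
  obtain ⟨_, _, hf⟩ := ExactCategory.effective _ _ R.2.isEquivalenceRelation
  exact Regular.hasCoequalizer_of_isKernelPair hf

/-- The quotient `A/R`: the coequalizer of the two legs of `R`. -/
def InternalEquivalence.quotient {A : C} (R : InternalEquivalence A) : C :=
  coequalizer R.1.fst R.1.snd

/-- The canonical quotient `q : A ⟶ A/R`. -/
def InternalEquivalence.proj {A : C} (R : InternalEquivalence A) : A ⟶ R.quotient :=
  coequalizer.π R.1.fst R.1.snd

/-- Pairs `(R, ≤)` with `R` an equivalence relation on `A` and `≤` a partial order on `A/R`. -/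
abbrev EquivalencePartialOrderPair (A : C) :=
  Σ R : InternalEquivalence A, InternalPartialOrder R.quotient

end Exact

end InternalOrder

end

open InternalOrder

namespace InternalOrder

namespace InternalRel

section FiniteLimits

variable {C : Type u} [Category.{v} C] [HasFiniteLimits C] {A B : C}

/-! A relation is determined by the pairs of generalized elements `x y : T ⟶ A` factoring through
it, so one can argue as with sets, except that existence holds only on a strong-epi cover. Exactness
makes `q_R` a regular epi with kernel pair `R`: elements of `A/R` lift to `A` on a cover, and
membership descends along covers. The crux is `directImage_factors_iff`: `π a` and `π b` are related
by `π(ρ)` iff `a ρ b`, as changing representatives within `∼_ρ` is absorbed by transitivity. This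
makes `π(ρ)` a partial order with preimage `ρ`. Conversely, antisymmetry of `≤` forces `∼` of
`q_R⁻¹(≤)` to be the kernel pair `R`. -/

theorem le_iff (r s : InternalRel A) :
    r ≤ s ↔ ∀ ⦃T : C⦄ (x y : T ⟶ A), r.Factors (prod.lift x y) → s.Factors (prod.lift x y) := by
  refine ⟨fun h _ _ _ => Subobject.factors_of_le _ h, fun h => Subobject.le_of_factors ?_⟩
  -- It suffices to test the generic pair, the two legs of `r`.
  rw [← r.lift_fst_snd]
  exact h _ _ ((r.factors_iff _ _).2 ⟨𝟙 _, by simp, by simp⟩)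

theorem ext_factors {r s : InternalRel A}
    (h : ∀ ⦃T : C⦄ (x y : T ⟶ A), r.Factors (prod.lift x y) ↔ s.Factors (prod.lift x y)) :
    r = s :=
  le_antisymm ((le_iff _ _).2 fun _ x y => (h x y).1) ((le_iff _ _).2 fun _ x y => (h x y).2)

theorem factors_comp {r : InternalRel A} {T S : C} (p : S ⟶ T) {x y : T ⟶ A}
    (h : r.Factors (prod.lift x y)) : r.Factors (prod.lift (p ≫ x) (p ≫ y)) := by
  rw [← prod.comp_lift]
  exact Subobject.factors_of_factors_right p h

/-- Membership in a relation descends along strong epimorphisms. -/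
theorem factors_of_strongEpi (r : InternalRel A) {T S : C} (p : S ⟶ T) [StrongEpi p] {x y : T ⟶ A}
    (h : r.Factors (prod.lift (p ≫ x) (p ≫ y))) : r.Factors (prod.lift x y) := by
  rw [← prod.comp_lift] at h
  have sq : CommSq (r.factorThru _ h) p r.arrow (prod.lift x y) := ⟨by simp⟩
  have := Subobject.factors_comp_arrow (P := r) sq.lift
  rwa [sq.fac_right] at this

theorem discrete_factors_iff {T : C} (x y : T ⟶ A) :
    (discrete A).Factors (prod.lift x y) ↔ x = y := by
  rw [discrete, Subobject.mk_factors_iff]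
  constructor
  · rintro ⟨(t : T ⟶ A), (ht : t ≫ diag A = prod.lift x y)⟩
    have h₁ := congrArg (· ≫ prod.fst) ht
    have h₂ := congrArg (· ≫ prod.snd) ht
    simp only [Category.assoc, prod.lift_fst, prod.lift_snd, diag, Category.comp_id] at h₁ h₂
    exact h₁.symm.trans h₂
  · rintro rfl
    exact ⟨x, by simp⟩

theorem IsReflexive.factors {r : InternalRel A} (h : r.IsReflexive) {T : C} (x : T ⟶ A) :
    r.Factors (prod.lift x x) :=
  Subobject.factors_of_le _ h ((discrete_factors_iff _ _).2 rfl)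

theorem IsReflexive.isAntisymmetric_iff {r : InternalRel A} (hr : r.IsReflexive) :
    r.IsAntisymmetric ↔ ∀ ⦃T : C⦄ (x y : T ⟶ A), r.Factors (prod.lift x y) →
      r.Factors (prod.lift y x) → x = y := by
  constructor
  · intro h T x y hxy hyx
    rw [← discrete_factors_iff, ← show r.sim = discrete A from h, sim_factors_iff]
    exact ⟨hxy, hyx⟩
  · refine fun h => ext_factors fun T x y => ?_
    rw [sim_factors_iff, discrete_factors_iff]
    refine ⟨fun hxy => h _ _ hxy.1 hxy.2, ?_⟩
    rintro rfl
    exact ⟨hr.factors x, hr.factors x⟩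

theorem inverseImage_factors_iff (f : A ⟶ B) (s : InternalRel B) {T : C} (x y : T ⟶ A) :
    (inverseImage f s).Factors (prod.lift x y) ↔ s.Factors (prod.lift (x ≫ f) (y ≫ f)) := by
  rw [inverseImage, Limits.pullback_factors_iff, prod.lift_map]

theorem IsPreorder.inverseImage (f : A ⟶ B) {s : InternalRel B} (h : s.IsPreorder) :
    (inverseImage f s).IsPreorder where
  refl := (isReflexive_iff _).2 ((inverseImage_factors_iff _ _ _ _).2 (h.refl.factors _))
  trans := by
    refine (isTransitive_iff _).2 fun T x y z hxy hyz => ?_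
    rw [inverseImage_factors_iff] at *
    exact (isTransitive_iff _).1 h.trans _ _ _ hxy hyz

end FiniteLimits

section Exact

variable {C : Type u} [Category.{v} C] [ExactCategory C] {A B : C}

theorem directImage_factors (f : A ⟶ B) (r : InternalRel A) {T : C} {x y : T ⟶ A}
    (h : r.Factors (prod.lift x y)) :
    (directImage f r).Factors (prod.lift (x ≫ f) (y ≫ f)) := by
  rw [← prod.lift_map, ← r.factorThru_arrow _ h, Category.assoc]
  exact imageSubobject_factors_comp_self _ _

/-- Membership in a direct image means membership in the original relation on a cover. -/
theorem exists_of_directImage_factors (f : A ⟶ B) (r : InternalRel A) {T : C} {x y : T ⟶ B}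
    (h : (directImage f r).Factors (prod.lift x y)) :
    ∃ (S : C) (p : S ⟶ T) (_ : StrongEpi p) (a b : S ⟶ A),
      a ≫ f = p ≫ x ∧ b ≫ f = p ≫ y ∧ r.Factors (prod.lift a b) := by
  let t := (directImage f r).factorThru _ h
  let e : (r : C) ⟶ (directImage f r : C) :=
    factorThruImageSubobject (r.arrow ≫ prod.map f f)
  have : StrongEpi e := by
    have : StrongEpi (factorThruImage (r.arrow ≫ prod.map f f)) := inferInstance
    exact strongEpi_comp _ (imageSubobjectIso _).inv
  have key : pullback.fst t e ≫ prod.lift x y =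
      (pullback.snd t e ≫ r.arrow) ≫ prod.map f f := by
    rw [← (directImage f r).factorThru_arrow _ h, pullback.condition_assoc, Category.assoc]
    congr 1
    exact imageSubobject_arrow_comp _
  -- The cover is the pullback of the strong epi `e`, hence again a strong epi.
  refine ⟨pullback t e, pullback.fst t e, inferInstance,
    pullback.snd t e ≫ r.fst, pullback.snd t e ≫ r.snd, ?_, ?_,
    (r.factors_iff _ _).2 ⟨pullback.snd t e, rfl, rfl⟩⟩
  · simpa [fst, prod.lift_fst] using (congrArg (· ≫ prod.fst) key).symm
  · simpa [snd, prod.lift_snd] using (congrArg (· ≫ prod.snd) key).symm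

end Exact

end InternalRel

open InternalRel

section Exact

variable {C : Type u} [Category.{v} C] [ExactCategory C] {A : C}

namespace InternalEquivalence

instance (R : InternalEquivalence A) : IsRegularEpi R.proj :=
  inferInstanceAs (IsRegularEpi (coequalizer.π R.1.fst R.1.snd))

/-- An equivalence relation is the kernel pair of its quotient. -/
theorem factors_iff_comp_proj_eq (R : InternalEquivalence A) {T : C} (x y : T ⟶ A) :
    R.1.Factors (prod.lift x y) ↔ x ≫ R.proj = y ≫ R.proj := by
  constructor
  · intro h
    obtain ⟨t, rfl, rfl⟩ := (InternalRel.factors_iff _ _ _).1 h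
    rw [Category.assoc, Category.assoc]
    exact congrArg (t ≫ ·) (coequalizer.condition R.1.fst R.1.snd)
  · intro h
    -- `R` is the kernel pair of some `f`, which factors through the quotient; so `f` identifies
    -- whatever `R.proj` does.
    obtain ⟨Y, f, hf⟩ := ExactCategory.effective _ _ R.2.isEquivalenceRelation
    have hxy : x ≫ f = y ≫ f := by
      obtain ⟨g, hg⟩ : ∃ g : R.quotient ⟶ Y, R.proj ≫ g = f :=
        ⟨coequalizer.desc f hf.w, coequalizer.π_desc _ _⟩
      rw [← hg, reassoc_of% h]
    exact (InternalRel.factors_iff _ _ _).2 ⟨hf.lift x y hxy, by simp, by simp⟩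

theorem exists_lift (R : InternalEquivalence A) {T : C} (x : T ⟶ R.quotient) :
    ∃ (S : C) (p : S ⟶ T) (_ : StrongEpi p) (a : S ⟶ A), a ≫ R.proj = p ≫ x :=
  ⟨pullback x R.proj, pullback.fst _ _, inferInstance, pullback.snd _ _, pullback.condition.symm⟩

theorem exists_lift₂ (R : InternalEquivalence A) {T : C} (x y : T ⟶ R.quotient) :
    ∃ (S : C) (p : S ⟶ T) (_ : StrongEpi p) (a b : S ⟶ A),
      a ≫ R.proj = p ≫ x ∧ b ≫ R.proj = p ≫ y := by
  obtain ⟨S, p, _, a, ha⟩ := R.exists_lift x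
  -- Lifting over the first cover gives both representatives a common domain.
  obtain ⟨S', p', _, b, hb⟩ := R.exists_lift (p ≫ y)
  exact ⟨S', p' ≫ p, inferInstance, p' ≫ a, b, by simp [ha], by simp [hb]⟩

theorem ext_factors_comp_proj (R : InternalEquivalence A) {r s : InternalRel R.quotient}
    (h : ∀ ⦃T : C⦄ (a b : T ⟶ A), r.Factors (prod.lift (a ≫ R.proj) (b ≫ R.proj)) ↔
      s.Factors (prod.lift (a ≫ R.proj) (b ≫ R.proj))) : r = s := by
  refine InternalRel.ext_factors fun T x y => ?_
  obtain ⟨S, p, _, a, b, ha, hb⟩ := R.exists_lift₂ x y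
  have hab := h a b
  rw [ha, hb] at hab
  exact ⟨fun hxy => s.factors_of_strongEpi p (hab.1 (factors_comp p hxy)),
    fun hxy => r.factors_of_strongEpi p (hab.2 (factors_comp p hxy))⟩

end InternalEquivalence

namespace InternalPreorder

theorem directImage_factors_iff (ρ : InternalPreorder A) {T : C} (a b : T ⟶ A) :
    (directImage ρ.sim.proj ρ.1).Factors (prod.lift (a ≫ ρ.sim.proj) (b ≫ ρ.sim.proj)) ↔
      ρ.1.Factors (prod.lift a b) := by
  refine ⟨fun h => ?_, directImage_factors _ _⟩
  obtain ⟨S, p, _, a', b', ha, hb, hab⟩ := exists_of_directImage_factors _ _ h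
  have htrans := (isTransitive_iff _).1 ρ.2.trans
  rw [← Category.assoc, ← ρ.sim.factors_iff_comp_proj_eq] at ha hb
  have ha' := (ρ.1.sim_factors_iff _ _).1 ha
  have hb' := (ρ.1.sim_factors_iff _ _).1 hb
  -- On the cover, `p ≫ a ρ a' ρ b' ρ p ≫ b`.
  exact ρ.1.factors_of_strongEpi p (htrans _ _ _ (htrans _ _ _ ha'.2 hab) hb'.1)

theorem isPartialOrder_directImage (ρ : InternalPreorder A) :
    (directImage ρ.sim.proj ρ.1).IsPartialOrder := by
  have hrefl : (directImage ρ.sim.proj ρ.1).IsReflexive := by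
    rw [isReflexive_iff]
    -- The quotient map itself covers the generic element of the quotient, with lift `𝟙 A`.
    refine factors_of_strongEpi _ ρ.sim.proj ?_
    simpa using directImage_factors ρ.sim.proj _ (ρ.2.refl.factors (𝟙 A))
  refine ⟨⟨hrefl, (isTransitive_iff _).2 fun T x y z hxy hyz => ?_⟩,
    hrefl.isAntisymmetric_iff.2 fun T x y hxy hyx => ?_⟩
  · obtain ⟨S, p, _, a, b, ha, hb⟩ := ρ.sim.exists_lift₂ x y
    obtain ⟨S', p', _, c, hc⟩ := ρ.sim.exists_lift (p ≫ z)
    have hxy' := factors_comp p' (factors_comp p hxy)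
    have hyz' := factors_comp p' (factors_comp p hyz)
    refine factors_of_strongEpi _ p (factors_of_strongEpi _ p' ?_)
    rw [← ha, ← hb, ← Category.assoc, ← Category.assoc, directImage_factors_iff] at hxy'
    rw [← hb, ← hc, ← Category.assoc, directImage_factors_iff] at hyz'
    rw [← ha, ← hc, ← Category.assoc, directImage_factors_iff]
    exact (isTransitive_iff _).1 ρ.2.trans _ _ _ hxy' hyz'
  · obtain ⟨S, p, _, a, b, ha, hb⟩ := ρ.sim.exists_lift₂ x y
    have hxy' := factors_comp p hxy
    have hyx' := factors_comp p hyx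
    rw [← ha, ← hb, directImage_factors_iff] at hxy' hyx'
    rw [← cancel_epi p, ← ha, ← hb, ← ρ.sim.factors_iff_comp_proj_eq]
    exact (ρ.1.sim_factors_iff _ _).2 ⟨hxy', hyx'⟩

/-- The quotient of a preorder by its associated equivalence relation. -/
noncomputable def toPair (ρ : InternalPreorder A) : EquivalencePartialOrderPair A :=
  ⟨ρ.sim, ⟨directImage ρ.sim.proj ρ.1, ρ.isPartialOrder_directImage⟩⟩

/-- The preorder induced by a partial order on a quotient. -/
noncomputable def ofPair (p : EquivalencePartialOrderPair A) : InternalPreorder A :=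
  ⟨inverseImage p.1.proj p.2.1, p.2.2.toIsPreorder.inverseImage _⟩

theorem ofPair_toPair (ρ : InternalPreorder A) : ofPair ρ.toPair = ρ :=
  Subtype.ext <| InternalRel.ext_factors fun _ a b =>
    (inverseImage_factors_iff _ _ a b).trans (ρ.directImage_factors_iff a b)

theorem sim_ofPair (p : EquivalencePartialOrderPair A) : (ofPair p).sim = p.1 := by
  refine Subtype.ext <| InternalRel.ext_factors fun T a b => ?_
  rw [p.1.factors_iff_comp_proj_eq]
  refine (sim_factors_iff _ a b).trans ?_
  simp only [ofPair, inverseImage_factors_iff]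
  constructor
  · exact fun h => p.2.2.refl.isAntisymmetric_iff.1 p.2.2.antisymm _ _ h.1 h.2
  · intro h
    rw [h]
    exact ⟨p.2.2.refl.factors _, p.2.2.refl.factors _⟩

/-- The type of `s` depends on `R`. Keeping `R` a variable lets `hR` be substituted, which avoids
transporting a partial order between quotients. -/
theorem toPair_eq_of_inverseImage (ρ : InternalPreorder A) (R : InternalEquivalence A)
    (hR : ρ.sim = R) (s : InternalPartialOrder R.quotient)
    (hs : ρ.1 = inverseImage R.proj s.1) : ρ.toPair = ⟨R, s⟩ := by
  subst hR
  refine congrArg (Sigma.mk ρ.sim) (Subtype.ext ?_)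
  refine ρ.sim.ext_factors_comp_proj fun T a b => ?_
  refine (ρ.directImage_factors_iff a b).trans ?_
  rw [hs, inverseImage_factors_iff]

theorem toPair_ofPair (p : EquivalencePartialOrderPair A) : (ofPair p).toPair = p :=
  toPair_eq_of_inverseImage _ p.1 (sim_ofPair p) p.2 rfl

/-- Preorders on `A` correspond to partial orders on quotients of `A`. -/
noncomputable def equivPair (A : C) : InternalPreorder A ≃ EquivalencePartialOrderPair A where
  toFun := toPair
  invFun := ofPair
  left_inv := ofPair_toPair
  right_inv := toPair_ofPair

end InternalPreorder

end Exact

end InternalOrder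

theorem mainTheorem11 {C : Type u} [Category.{v} C] [ExactCategory C] (A : C) :
    ∃ (hdir : ∀ ρ : InternalPreorder A,
        (InternalRel.directImage ρ.sim.proj ρ.1).IsPartialOrder)
      (hinv : ∀ p : EquivalencePartialOrderPair A,
        (InternalRel.inverseImage p.1.proj p.2.1).IsPreorder)
      (e : InternalPreorder A ≃ EquivalencePartialOrderPair A),
      (∀ ρ : InternalPreorder A,
        e ρ = ⟨ρ.sim, ⟨InternalRel.directImage ρ.sim.proj ρ.1, hdir ρ⟩⟩) ∧
      (∀ p : EquivalencePartialOrderPair A,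
        e.symm p = ⟨InternalRel.inverseImage p.1.proj p.2.1, hinv p⟩) :=
  ⟨fun ρ => ρ.isPartialOrder_directImage, fun p => p.2.2.toIsPreorder.inverseImage _,
    InternalPreorder.equivPair A, fun _ => rfl, fun _ => rfl⟩
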